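/- \textbf{Setting.} Let $n\ge 1$, $\vartheta\in(0,\infty)$, $V_n=\{1,\dots,n\}$, and let $V_n^{(2)}$ be the set of unordered pairs of distinct vertices. Let $\mathbf W=(W_u)_{u\in V_n}$ be (possibly random) connectivity weights with values in $(0,\infty)$, and write $\mathcal F_n=\sigma(\mathbf W)$; $\mathbb E_n$ and $\operatorname{cov}_n$ denote expectation and covariance under the (regular) conditional law given $\mathcal F_n$. Let $\mu_V,\mu_E$ be probability measures on $\mathbb R$. Conditionally on $\mathcal F_n$ let $$X_{\{u,v\}}\sim\mathrm{Bernoulli}\Bigl(\tfrac{W_uW_v}{n\vartheta}\wedge 1\Bigr)\ (\{u,v\}\in V_n^{(2)}),\qquad w_u\sim\mu_V\ (u\in V_n),\qquad w_e\sim\mu_E\ (e\in V_n^{(2)})$$ be independent, and let $(\mathbf X',\mathbf w')$ be a conditionally independent copy of $(\mathbf X,\mathbf w)$. Let $\mathbf G_n$ be the weighted graph on $V_n$ with edge set $\{e: X_e=1\}$, vertex weights $w_u$ and edge weights $w_e$. For $F\subseteq V_n\cup V_n^{(2)}$ let $\mathbf G_n^F$ be obtained from $\mathbf G_n$ by replacing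 $X_e$ by $X'_e$ for $e\in F\cap V_n^{(2)}$ and $w_z$ by $w'_z$ for $z\in F$. For a weighted graph $\mathbf G$, let $B_\ell(v,\mathbf G)$ be the weighted subgraph of $\mathbf G$ consisting of all vertices and edges that lie on a path of length at most $\ell$ starting in $v$, with their weights. Put $\Gamma_{p,n}=\frac1{n\vartheta}\sum_{u\in V_n}W_u^p$, and $\|\mathcal U\|=\sum_{u\in\mathcal U}W_u$ for $\mathcal U\subseteq V_n$. \textbf{Lemma.} There is a universal constant $C>0$ such that the following holds in every such setting. Let $v_1,\dots,v_m,v_1',\dots,v_{m'}'$ be $m+m'$ distinct vertices of $V_n$ ($m,m'\ge 0$), let $F,F'\subseteq V_n\cup V_n^{(2)}$ and $\ell\in\{0,1,2,\dots\}$, and set $$\mathbf B_\ell=\bigl(B_\ell(v_i,\mathbf G_n),B_\ell(v_i,\mathbf G_n^F)\bigr)_{i=1}^m,\qquad \mathbf B'_\ell=\bigl(B_\ell(v'_i,\mathbf G_n),B_\ell(v'_i,\mathbf G_n^{F'})\bigr)_{i=1}^{m'} .$$ Then, almost surely, $$\sup_{g,g'}\operatorname{cov}_n\bigl(g(\mathbf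 B_\ell),g'(\mathbf B'_\ell)\bigr)\le\min\Bigl\{\frac{\sum_{i,i'}(W_{v_i}+1)(W_{v'_{i'}}+1)}{n\vartheta}(\Gamma_{3,n}+1)(\Gamma_{2,n}+C)^{2\ell+1},\,1\Bigr\},$$ where the supremum is over all measurable real-valued functions $g,g'$ bounded by $1$ in absolute value. Equivalently, with $\mathcal V=\{v_1,\dots,v_m\}$ and $\mathcal V'=\{v'_1,\dots,v'_{m'}\}$, almost surely $$\sup_{g,g'}\operatorname{cov}_n\bigl(g(\mathbf B_\ell),g'(\mathbf B'_\ell)\bigr)\le\min\Bigl\{\frac{(\|\mathcal V\|+|\mathcal V|)(\|\mathcal V'\|+|\mathcal V'|)}{n\vartheta}(\Gamma_{3,n}+1)(\Gamma_{2,n}+C)^{2\ell+1},\,1\Bigr\}.$$ For each fixed pair $g,g'$ the same bounds hold almost surely for $\mathbb E[g(\mathbf B_\ell)g'(\mathbf B'_\ell)\mid\mathcal F_n]-\mathbb E[g(\mathbf B_\ell)\mid\mathcal F_n]\,\mathbb E[g'(\mathbf B'_\ell)\mid\mathcal F_n]$. -/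

import Mathlib

open MeasureTheory ProbabilityTheory

noncomputable section

namespace InhomGraph

/-- The possible edges on the vertex set `Fin n`: unordered pairs of distinct vertices. -/
abbrev Edge (n : ℕ) : Type := {e : Sym2 (Fin n) // ¬ e.IsDiag}

/-- Vertices and possible edges together. -/
abbrev Site (n : ℕ) : Type := Fin n ⊕ Edge n

/-- The data `(X, w)` of a weighted graph on `Fin n`: the edge indicators `X` and the weights `w`
of all vertices and of all possible edges. -/
abbrev Config (n : ℕ) : Type := (Edge n → Bool) × (Site n → ℝ)

/-- The data `((X, w), (X', w'))` of a weighted graph together with a second copy of its data. -/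
abbrev Noise (n : ℕ) : Type := Config n × Config n

instance (n : ℕ) : StandardBorelSpace (Config n) := inferInstance

instance (n : ℕ) : StandardBorelSpace (Noise n) := StandardBorelSpace.prod

/-- The edge probability `W_u W_v / (n ϑ) ∧ 1` of `e = {u, v}`. -/
def edgeProb {n : ℕ} (ϑ : ℝ) (W : Fin n → ℝ) (e : Edge n) : ℝ :=
  min (Sym2.lift ⟨fun u v => W u * W v / (n * ϑ), fun u v => by simp only [mul_comm]⟩ e.1) 1

/-- The law of `(X, w)` for given connectivity weights `W`: all coordinates are independent,
`X_e` is Bernoulli with parameter `edgeProb ϑ W e`, vertex weights have law `μV` and edge weights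
have law `μE`. (The projection to `[0, 1]` only packages the parameter, which already lies there
when `ϑ` and the entries of `W` are positive.) -/
def configLaw {n : ℕ} (ϑ : ℝ) (μV μE : Measure ℝ) (W : Fin n → ℝ) : Measure (Config n) :=
  (Measure.pi fun e : Edge n =>
      bernoulliMeasure true false (Set.projIcc (0 : ℝ) 1 zero_le_one (edgeProb ϑ W e))).prod
    (Measure.pi fun z : Site n => Sum.elim (fun _ => μV) (fun _ => μE) z)

/-- The law of `((X, w), (X', w'))` for given connectivity weights: two independent copies. -/
def noiseLaw {n : ℕ} (ϑ : ℝ) (μV μE : Measure ℝ) (W : Fin n → ℝ) : Measure (Noise n) :=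
  (configLaw ϑ μV μE W).prod (configLaw ϑ μV μE W)

/-- On the probability space `(Ω, μ)`, the positive random connectivity weights `W` and the data
`ξ = ((X, w), (X', w'))` form a weighted rank-one inhomogeneous random graph with an independent
copy of its data: the conditional law of `ξ` given `W` is `noiseLaw ϑ μV μE W`. -/
structure IsModel {Ω : Type*} [MeasurableSpace Ω] (μ : Measure Ω) [IsProbabilityMeasure μ]
    {n : ℕ} (ϑ : ℝ) (μV μE : Measure ℝ) (W : Ω → Fin n → ℝ) (ξ : Ω → Noise n) : Prop where
  measurable_W : Measurable W
  measurable_ξ : Measurable ξ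
  W_pos : ∀ ω u, 0 < W ω u
  condLaw : ∀ᵐ ω ∂μ, condDistrib ξ W μ (W ω) = noiseLaw ϑ μV μE (W ω)

open Classical in
/-- The data of the perturbed graph `G^F`: the coordinates of `(X, w)` at sites in `F` are replaced
by those of `(X', w')`. -/
def perturb {n : ℕ} (F : Set (Site n)) (ζ : Noise n) : Config n :=
  (fun e => if Sum.inr e ∈ F then ζ.2.1 e else ζ.1.1 e,
   fun z => if z ∈ F then ζ.2.2 z else ζ.1.2 z)

/-- The graph with edge indicators `c.1`. -/
def graph {n : ℕ} (c : Config n) : SimpleGraph (Fin n) where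
  Adj u v := ∃ h : ¬ (s(u, v)).IsDiag, c.1 ⟨s(u, v), h⟩ = true
  symm := ⟨fun u v => by rw [Sym2.eq_swap]; exact id⟩
  loopless := ⟨fun _ h => h.1 rfl⟩

/-- A weighted graph whose vertices lie in `Fin n`. The weight function of the graph is the
restriction of `weight` to the vertices and edges; it is extended by `0` to all other sites. -/
structure WeightedGraph (n : ℕ) where
  verts : Set (Fin n)
  edges : Set (Edge n)
  weight : Site n → ℝ
  weight_eq_zero : ∀ z, z ∉ Sum.inl '' verts ∪ Sum.inr '' edges → weight z = 0

instance (n : ℕ) : MeasurableSpace (WeightedGraph n) :=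
  MeasurableSpace.comap (fun H => (H.verts, H.edges, H.weight)) inferInstance

/-- The vertices on paths of length at most `ℓ` starting in `v`. -/
def ballVerts {n : ℕ} (ℓ : ℕ) (v : Fin n) (c : Config n) : Set (Fin n) :=
  {u | ∃ p : (graph c).Walk v u, p.IsPath ∧ p.length ≤ ℓ}

/-- The edges on paths of length at most `ℓ` starting in `v`. -/
def ballEdges {n : ℕ} (ℓ : ℕ) (v : Fin n) (c : Config n) : Set (Edge n) :=
  {e | ∃ (u : Fin n) (p : (graph c).Walk v u), p.IsPath ∧ p.length ≤ ℓ ∧ e.1 ∈ p.edges}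

/-- The weighted `ℓ`-neighbourhood of `v`: the union of all paths of length at most `ℓ` starting
in `v`, with the weights of its vertices and edges. -/
def nbhd {n : ℕ} (ℓ : ℕ) (v : Fin n) (c : Config n) : WeightedGraph n where
  verts := ballVerts ℓ v c
  edges := ballEdges ℓ v c
  weight := Set.indicator (Sum.inl '' ballVerts ℓ v c ∪ Sum.inr '' ballEdges ℓ v c) c.2
  weight_eq_zero _ hz := Set.indicator_of_notMem hz _

/-- The `ℓ`-neighbourhoods of `v_1, …, v_m`, each in the original graph and in the graph
perturbed at `F`. -/
def nbhds {n m : ℕ} (ℓ : ℕ) (F : Set (Site n)) (v : Fin m → Fin n) (ζ : Noise n) :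
    Fin m → WeightedGraph n × WeightedGraph n :=
  fun i => (nbhd ℓ (v i) ζ.1, nbhd ℓ (v i) (perturb F ζ))

/-- `Γ_p = (n ϑ)⁻¹ ∑_u W_u ^ p`. -/
def Gam {n : ℕ} (ϑ : ℝ) (W : Fin n → ℝ) (p : ℕ) : ℝ :=
  (∑ u, W u ^ p) / (n * ϑ)

/-- The total connectivity weight `‖U‖ = ∑_{u ∈ U} W_u`. -/
def totalWeight {n : ℕ} (W : Fin n → ℝ) (U : Finset (Fin n)) : ℝ :=
  ∑ u ∈ U, W u

/-- `min {A / (n ϑ) * (Γ_3 + 1) * (Γ_2 + C) ^ (2 ℓ + 1), 1}`. -/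
def covBound {n : ℕ} (ϑ C : ℝ) (ℓ : ℕ) (W : Fin n → ℝ) (A : ℝ) : ℝ :=
  min (A / (n * ϑ) * (Gam ϑ W 3 + 1) * (Gam ϑ W 2 + C) ^ (2 * ℓ + 1)) 1

/-- The bound in terms of the individual root vertices. -/
def rootBound {n m m' : ℕ} (ϑ C : ℝ) (ℓ : ℕ) (v : Fin m → Fin n) (v' : Fin m' → Fin n)
    (W : Fin n → ℝ) : ℝ :=
  covBound ϑ C ℓ W (∑ i, ∑ i', (W (v i) + 1) * (W (v' i') + 1))

/-- The bound in terms of the sets of root vertices. -/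
def setBound {n : ℕ} (ϑ C : ℝ) (ℓ : ℕ) (𝒱 𝒱' : Finset (Fin n)) (W : Fin n → ℝ) : ℝ :=
  covBound ϑ C ℓ W
    ((totalWeight W 𝒱 + (𝒱.card : ℝ)) * (totalWeight W 𝒱' + (𝒱'.card : ℝ)))

/-- The conditional covariance of `Y` and `Z` given the sub-σ-algebra `m`. -/
def condCov {Ω : Type*} [MeasurableSpace Ω] (μ : Measure Ω) (m : MeasurableSpace Ω)
    (Y Z : Ω → ℝ) : Ω → ℝ :=
  μ[fun ω => Y ω * Z ω | m] - μ[Y | m] * μ[Z | m]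

end InhomGraph

end

noncomputable section

namespace InhomGraph

/-! ### Product laws and resampling of coordinates. -/

section Measure

/-! Reveal the neighbourhoods of the `v i` in both graphs. The explored set of sites is determined
by the data on that set, so all other sites may be replaced by those of an independent noise: for
independent `p.1`, `p.2`, the noise equal to `p.1` on the set explored from `p.1` and to `p.2`
elsewhere again has law `noiseLaw`. It has the first family of neighbourhoods of `p.1`, and the
second family of `p.2` unless some vertex is touched from a `v i` in `p.1` and from a `v' i'` in
`p.2`. Hence the covariance is at most twice the probability of such a meeting
(`covariance_le_of_resampling`, `nbhds_merge_of_disjoint`).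

As `p.1` and `p.2` are independent, a union bound leaves a sum over `a` of products of touching
probabilities. A first moment bound over trails gives `noiseLaw_mem_touched_le`; the rank-one form
of the edge probabilities turns each interior vertex of a trail, and the meeting vertex, into a
factor `Γ_2`. Geometric sums are absorbed in `geom_bound`, and `condDistrib` carries the result to
random `W`. -/

theorem measurePreserving_prod_prod_comm {A B C D : Type*} [MeasurableSpace A] [MeasurableSpace B]
    [MeasurableSpace C] [MeasurableSpace D] (μ : Measure A) (ν : Measure B) (μ' : Measure C)
    (ν' : Measure D) [SigmaFinite μ] [SigmaFinite ν] [SigmaFinite μ'] [SigmaFinite ν'] :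
    MeasurePreserving (fun p : (A × B) × (C × D) => ((p.1.1, p.2.1), (p.1.2, p.2.2)))
      ((μ.prod ν).prod (μ'.prod ν')) ((μ.prod μ').prod (ν.prod ν')) := by
  have inner : MeasurePreserving (fun p : B × (C × D) => (p.2.1, (p.1, p.2.2)))
      (ν.prod (μ'.prod ν')) (μ'.prod (ν.prod ν')) :=
    (measurePreserving_prodAssoc μ' ν ν').comp
      (((Measure.measurePreserving_swap (μ := ν) (ν := μ')).prod (MeasurePreserving.id ν')).comp
        (measurePreserving_prodAssoc ν μ' ν').symm)
  exact (measurePreserving_prodAssoc μ μ' (ν.prod ν')).symm.comp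
    (((MeasurePreserving.id μ).prod inner).comp (measurePreserving_prodAssoc μ ν (μ'.prod ν')))

open Classical in
-- The preimage of a box is a product of two boxes; each side `t i` occurs in exactly one of them,
-- opposite a factor of mass one.
theorem measurePreserving_pi_ite {ι : Type*} [Fintype ι] {α : ι → Type*}
    [∀ i, MeasurableSpace (α i)] (μ : ∀ i, Measure (α i)) [∀ i, IsProbabilityMeasure (μ i)]
    (s : Set ι) :
    MeasurePreserving (fun p : (∀ i, α i) × (∀ i, α i) => fun i => if i ∈ s then p.2 i else p.1 i)
      ((Measure.pi μ).prod (Measure.pi μ)) (Measure.pi μ) := by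
  have hm : Measurable
      (fun p : (∀ i, α i) × (∀ i, α i) => fun i => if i ∈ s then p.2 i else p.1 i) := by
    refine measurable_pi_lambda _ fun i => ?_
    by_cases h : i ∈ s <;> simp only [h, if_true, if_false] <;> fun_prop
  refine ⟨hm, (Measure.pi_eq fun t ht => ?_).symm⟩
  rw [Measure.map_apply hm (MeasurableSet.univ_pi ht)]
  have hpre : (fun p : (∀ i, α i) × (∀ i, α i) => fun i => if i ∈ s then p.2 i else p.1 i) ⁻¹'
      (Set.univ.pi t) = (Set.univ.pi fun i => if i ∈ s then Set.univ else t i) ×ˢ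
        (Set.univ.pi fun i => if i ∈ s then t i else Set.univ) := by
    ext p
    simp only [Set.mem_preimage, Set.mem_pi, Set.mem_univ, true_implies, Set.mem_prod]
    rw [← forall_and]
    refine forall_congr' fun i => ?_
    by_cases h : i ∈ s <;> simp [h]
  rw [hpre, Measure.prod_prod, Measure.pi_pi, Measure.pi_pi, ← Finset.prod_mul_distrib]
  refine Finset.prod_congr rfl fun i _ => ?_
  by_cases h : i ∈ s <;> simp [h]

variable {n : ℕ} {ϑ : ℝ} {μV μE : Measure ℝ} [IsProbabilityMeasure μV] [IsProbabilityMeasure μE]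
  {W : Fin n → ℝ}

instance isProbabilityMeasure_siteLaw (z : Site n) :
    IsProbabilityMeasure (Sum.elim (fun _ => μV) (fun _ => μE) z : Measure ℝ) := by
  cases z <;> simp only [Sum.elim_inl, Sum.elim_inr] <;> infer_instance

instance isProbabilityMeasure_configLaw : IsProbabilityMeasure (configLaw ϑ μV μE W) := by
  unfold configLaw; infer_instance

instance isProbabilityMeasure_noiseLaw : IsProbabilityMeasure (noiseLaw ϑ μV μE W) := by
  unfold noiseLaw; infer_instance

/-- This reduces events in any perturbed graph to estimates for a single configuration. -/
theorem measurePreserving_perturb (F : Set (Site n)) :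
    MeasurePreserving (perturb F) (noiseLaw ϑ μV μE W) (configLaw ϑ μV μE W) :=
  ((measurePreserving_pi_ite _ (Sum.inr ⁻¹' F)).prod (measurePreserving_pi_ite _ F)).comp
    (measurePreserving_prod_prod_comm _ _ _ _)

/-- The noise that agrees with `p.1` at the sites in `s` and with `p.2` at all other sites. -/
def merge (s : Set (Site n)) (p : Noise n × Noise n) : Noise n :=
  (perturb sᶜ (p.1.1, p.2.1), perturb sᶜ (p.1.2, p.2.2))

theorem measurePreserving_merge (s : Set (Site n)) :
    MeasurePreserving (merge s) ((noiseLaw ϑ μV μE W).prod (noiseLaw ϑ μV μE W))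
      (noiseLaw ϑ μV μE W) :=
  ((measurePreserving_perturb sᶜ).prod (measurePreserving_perturb sᶜ)).comp
    (measurePreserving_prod_prod_comm _ _ _ _)

theorem measurable_perturb (F : Set (Site n)) : Measurable (perturb F) :=
  -- Measurability does not involve the laws; the parameters are arbitrary.
  (measurePreserving_perturb (ϑ := 1) (μV := Measure.dirac 0) (μE := Measure.dirac 0)
    (W := fun _ => 1) F).measurable

theorem edgeProb_mem_Icc (hϑ : 0 < ϑ) (hW : ∀ u, 0 < W u) (e : Edge n) :
    edgeProb ϑ W e ∈ Set.Icc (0 : ℝ) 1 := by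
  refine ⟨?_, min_le_right _ _⟩
  obtain ⟨e, he⟩ := e
  induction e using Sym2.ind with
  | _ u v =>
    refine le_min ?_ zero_le_one
    simp only [Sym2.lift_mk]
    exact div_nonneg (mul_pos (hW u) (hW v)).le (by positivity)

theorem edgeProb_le (u v : Fin n) (h : ¬ (s(u, v)).IsDiag) :
    edgeProb ϑ W ⟨s(u, v), h⟩ ≤ W u * W v / (n * ϑ) :=
  min_le_left _ _

theorem configLaw_forall_open (hϑ : 0 < ϑ) (hW : ∀ u, 0 < W u) (E : Finset (Edge n)) :
    (configLaw ϑ μV μE W).real {c | ∀ e ∈ E, c.1 e = true} = ∏ e ∈ E, edgeProb ϑ W e := by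
  classical
  have hset : {c : Config n | ∀ e ∈ E, c.1 e = true} =
      (Set.univ.pi fun e => if e ∈ E then {true} else Set.univ) ×ˢ Set.univ := by
    ext c
    simp only [Set.mem_ofPred_eq, Set.mem_prod, Set.mem_pi, Set.mem_univ, true_implies, and_true]
    refine forall_congr' fun e => ?_
    by_cases h : e ∈ E <;> simp [h]
  rw [hset, configLaw, measureReal_prod_prod, probReal_univ, mul_one, measureReal_def,
    Measure.pi_pi, ENNReal.toReal_prod, ← Finset.prod_subset (Finset.subset_univ E)]
  · refine Finset.prod_congr rfl fun e he => ?_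
    rw [if_pos he, ← measureReal_def, bernoulliMeasure_real_apply_of_mem_of_notMem _
      (MeasurableSet.singleton _) (by simp) (by simp),
      Set.projIcc_of_mem _ (edgeProb_mem_Icc hϑ hW e)]
  · intro e _ he
    simp [he]

end Measure

/-! ### Neighbourhoods depend only on nearby data. -/

section Locality

variable {n : ℕ} {c c' : Config n} {ℓ k : ℕ} {v u : Fin n}

theorem mem_ballVerts_iff : u ∈ ballVerts ℓ v c ↔ ∃ p : (graph c).Walk v u, p.length ≤ ℓ := by
  classical
  constructor
  · rintro ⟨p, -, h⟩
    exact ⟨p, h⟩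
  · rintro ⟨p, h⟩
    exact ⟨p.bypass, p.bypass_isPath, p.length_bypass_le_length.trans h⟩

theorem ballVerts_mono (h : k ≤ ℓ) : ballVerts k v c ⊆ ballVerts ℓ v c :=
  fun _ ⟨p, hp, hl⟩ => ⟨p, hp, hl.trans h⟩

theorem mem_edgeSet_graph {e : Edge n} : e.1 ∈ (graph c).edgeSet ↔ c.1 e = true := by
  obtain ⟨e, he⟩ := e
  induction e using Sym2.ind with
  | _ a b => exact ⟨fun h => h.2, fun h => ⟨he, h⟩⟩

/-- The edge indicators of `c` and `c'` agree at every edge that is incident to a vertex at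
distance less than `ℓ` from `v` in `c`. -/
def AgreeNear (ℓ : ℕ) (v : Fin n) (c c' : Config n) : Prop :=
  ∀ e : Edge n, ∀ u ∈ e.1, ∀ k < ℓ, u ∈ ballVerts k v c → c.1 e = c'.1 e

theorem AgreeNear.edge_iff (h : AgreeNear ℓ v c c') {a b : Fin n} (hk : k < ℓ)
    (ha : a ∈ ballVerts k v c) : (graph c).Adj a b ↔ (graph c').Adj a b := by
  refine exists_congr fun hd => ?_
  rw [h ⟨s(a, b), hd⟩ a (Sym2.mem_mk_left a b) k hk ha]

theorem AgreeNear.edges_forward (h : AgreeNear ℓ v c c') (p : (graph c).Walk v u)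
    (hp : p.length ≤ ℓ) : ∀ e ∈ p.edges, e ∈ (graph c').edgeSet := by
  induction p using SimpleGraph.Walk.concatRec with
  | Hnil => simp
  | Hconcat p hadj ih =>
    rw [SimpleGraph.Walk.length_concat] at hp
    intro e he
    rw [SimpleGraph.Walk.edges_concat, List.concat_eq_append, List.mem_append,
      List.mem_singleton] at he
    rcases he with he | rfl
    · exact ih h (by omega) e he
    · exact (h.edge_iff hp (mem_ballVerts_iff.2 ⟨p, le_rfl⟩)).1 hadj

/-- `AgreeNear` refers to balls of `c` only. The prefix of a walk in `c'` must therefore be moved to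
`c` first; this puts its endpoint in a ball of `c` and makes the last edge comparable. -/
theorem AgreeNear.edges_backward (h : AgreeNear ℓ v c c') (p : (graph c').Walk v u)
    (hp : p.length ≤ ℓ) : ∀ e ∈ p.edges, e ∈ (graph c).edgeSet := by
  induction p using SimpleGraph.Walk.concatRec with
  | Hnil => simp
  | Hconcat p hadj ih =>
    rw [SimpleGraph.Walk.length_concat] at hp
    intro e he
    rw [SimpleGraph.Walk.edges_concat, List.concat_eq_append, List.mem_append,
      List.mem_singleton] at he
    have ih' := ih h (by omega)
    rcases he with he | rfl
    · exact ih' e he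
    · exact (h.edge_iff hp (mem_ballVerts_iff.2 ⟨p.transfer _ ih', by simp⟩)).2 hadj

theorem AgreeNear.ballVerts_eq (h : AgreeNear ℓ v c c') (hk : k ≤ ℓ) :
    ballVerts k v c = ballVerts k v c' := by
  ext u
  constructor
  · rintro ⟨p, hp, hl⟩
    exact ⟨_, hp.transfer (h.edges_forward p (hl.trans hk)), by simpa using hl⟩
  · rintro ⟨p, hp, hl⟩
    exact ⟨_, hp.transfer (h.edges_backward p (hl.trans hk)), by simpa using hl⟩

theorem AgreeNear.ballEdges_eq (h : AgreeNear ℓ v c c') : ballEdges ℓ v c = ballEdges ℓ v c' := by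
  ext e
  constructor
  · rintro ⟨u, p, hp, hl, he⟩
    exact ⟨u, _, hp.transfer (h.edges_forward p hl), by simpa using hl, by simpa using he⟩
  · rintro ⟨u, p, hp, hl, he⟩
    exact ⟨u, _, hp.transfer (h.edges_backward p hl), by simpa using hl, by simpa using he⟩

theorem AgreeNear.nbhd_eq (h : AgreeNear ℓ v c c')
    (hV : ∀ u ∈ ballVerts ℓ v c, c.2 (Sum.inl u) = c'.2 (Sum.inl u))
    (hE : ∀ e ∈ ballEdges ℓ v c, c.2 (Sum.inr e) = c'.2 (Sum.inr e)) :
    nbhd ℓ v c = nbhd ℓ v c' := by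
  have hw : (nbhd ℓ v c).weight = (nbhd ℓ v c').weight := by
    simp only [nbhd, ← h.ballVerts_eq le_rfl, ← h.ballEdges_eq]
    refine Set.indicator_congr ?_
    rintro z (⟨u, hu, rfl⟩ | ⟨e, he, rfl⟩)
    · exact hV u hu
    · exact hE e he
  have hv : (nbhd ℓ v c).verts = (nbhd ℓ v c').verts := h.ballVerts_eq le_rfl
  have he : (nbhd ℓ v c).edges = (nbhd ℓ v c').edges := h.ballEdges_eq
  revert hw hv he
  generalize nbhd ℓ v c = A
  generalize nbhd ℓ v c' = B
  obtain ⟨_, _, _, _⟩ := A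
  obtain ⟨_, _, _, _⟩ := B
  rintro rfl rfl rfl
  rfl

/-- Every edge of the `ℓ`-neighbourhood is incident to a vertex at distance less than `ℓ`. -/
theorem exists_mem_of_mem_ballEdges {e : Edge n} (he : e ∈ ballEdges ℓ v c) :
    ∃ a ∈ e.1, ∃ k < ℓ, a ∈ ballVerts k v c := by
  obtain ⟨u, p, -, hl, he⟩ := he
  induction p using SimpleGraph.Walk.concatRec with
  | Hnil => simp at he
  | @Hconcat x y z p hadj ih =>
    rw [SimpleGraph.Walk.length_concat] at hl
    rw [SimpleGraph.Walk.edges_concat, List.concat_eq_append, List.mem_append,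
      List.mem_singleton] at he
    rcases he with he | he
    · exact ih (by omega) he
    · exact ⟨y, by rw [he]; exact Sym2.mem_mk_left _ _, p.length, hl,
        mem_ballVerts_iff.2 ⟨p, le_rfl⟩⟩

theorem open_of_mem_ballEdges {e : Edge n} (he : e ∈ ballEdges ℓ v c) : c.1 e = true := by
  obtain ⟨u, p, -, hl, he⟩ := he
  exact mem_edgeSet_graph.1 (p.edges_subset_edgeSet he)

theorem ballVerts_congr (h : c.1 = c'.1) : ballVerts ℓ v c = ballVerts ℓ v c' :=
  AgreeNear.ballVerts_eq (ℓ := ℓ) (fun _ _ _ _ _ _ => by rw [h]) le_rfl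

theorem ballEdges_congr (h : c.1 = c'.1) : ballEdges ℓ v c = ballEdges ℓ v c' :=
  AgreeNear.ballEdges_eq (ℓ := ℓ) (fun _ _ _ _ _ _ => by rw [h])

/-- The edge indicators range over a finite discrete space. -/
theorem measurable_comp_indicators {α : Type*} [MeasurableSpace α] {f : Config n → α}
    (hf : ∀ c c' : Config n, c.1 = c'.1 → f c = f c') : Measurable f := by
  have : f = (fun x : Edge n → Bool => f (x, 0)) ∘ Prod.fst := by
    funext c; exact hf _ _ rfl
  rw [this]
  exact (Measurable.of_discrete).comp measurable_fst

theorem measurable_nbhd : Measurable (nbhd ℓ v) := by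
  classical
  rw [measurable_comap_iff]
  refine Measurable.prodMk (measurable_comp_indicators fun c c' h => ballVerts_congr h)
    (Measurable.prodMk (measurable_comp_indicators fun c c' h => ballEdges_congr h) ?_)
  refine measurable_pi_lambda _ fun z => ?_
  have hS : MeasurableSet
      {c : Config n | z ∈ Sum.inl '' ballVerts ℓ v c ∪ Sum.inr '' ballEdges ℓ v c} := by
    refine measurableSet_setOfPred.2 (measurable_comp_indicators fun c c' h => ?_)
    rw [ballVerts_congr h, ballEdges_congr h]
  exact Measurable.ite hS ((measurable_pi_apply z).comp measurable_snd) measurable_const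

theorem measurable_nbhds {m : ℕ} (F : Set (Site n)) (w : Fin m → Fin n) :
    Measurable (nbhds ℓ F w) :=
  measurable_pi_lambda _ fun _ => Measurable.prodMk (measurable_nbhd.comp measurable_fst)
    (measurable_nbhd.comp (measurable_perturb F))

end Locality

/-! ### First moment bound for open trails. -/

section Trails

variable {n : ℕ} {ϑ : ℝ} {μV μE : Measure ℝ} [IsProbabilityMeasure μV] [IsProbabilityMeasure μE]
  {W : Fin n → ℝ}

/-- The sum over all vertex sequences of length `k` from `u` to `v` of the products of the
`W_a W_b / (n ϑ)` along the sequence. -/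
def walkWeight (ϑ : ℝ) (W : Fin n → ℝ) : ℕ → Fin n → Fin n → ℝ
  | 0, u, v => if u = v then 1 else 0
  | k + 1, u, v => ∑ b, W u * W b / (n * ϑ) * walkWeight ϑ W k b v

/-- Each interior vertex `b` occurs in two consecutive factors, so summing over it gives `∑ W b ^ 2
/ (n * ϑ)`. -/
theorem walkWeight_succ_eq (k : ℕ) (u v : Fin n) :
    walkWeight ϑ W (k + 1) u v = W u * W v / (n * ϑ) * Gam ϑ W 2 ^ k := by
  induction k generalizing u with
  | zero => simp [walkWeight]
  | succ k ih =>
    rw [walkWeight]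
    simp_rw [ih, pow_succ]
    generalize Gam ϑ W 2 ^ k = g
    rw [Gam, Finset.sum_div, Finset.mul_sum, Finset.mul_sum]
    exact Finset.sum_congr rfl fun b _ => by ring

theorem walkWeight_nonneg (hϑ : 0 < ϑ) (hW : ∀ u, 0 < W u) (k : ℕ) (u v : Fin n) :
    0 ≤ walkWeight ϑ W k u v := by
  induction k generalizing u with
  | zero => rw [walkWeight]; split_ifs <;> norm_num
  | succ k ih =>
    rw [walkWeight]
    exact Finset.sum_nonneg fun b _ =>
      mul_nonneg (div_nonneg (mul_pos (hW u) (hW b)).le (by positivity)) (ih b)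

/-- All edges in `E` are open, and there is an open trail of length `k` from `u` to `v` that
uses none of them. -/
def trailEvent (E : Finset (Edge n)) (k : ℕ) (u v : Fin n) : Set (Config n) :=
  {c | (∀ e ∈ E, c.1 e = true) ∧
    ∃ p : (graph c).Walk u v, p.IsTrail ∧ p.length = k ∧ ∀ e ∈ E, e.1 ∉ p.edges}

/-- Induction on the length moves the first edge of the trail into `E`. A trail never reuses an
edge, so that edge is new to `E` and contributes its own factor; independence is needed only at
length zero, for the edges collected in `E`. -/
theorem configLaw_trailEvent_le (hϑ : 0 < ϑ) (hW : ∀ u, 0 < W u) (k : ℕ) (E : Finset (Edge n))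
    (u v : Fin n) :
    (configLaw ϑ μV μE W).real (trailEvent E k u v) ≤
      (∏ e ∈ E, edgeProb ϑ W e) * walkWeight ϑ W k u v := by
  classical
  have hprod : ∀ E : Finset (Edge n), 0 ≤ ∏ e ∈ E, edgeProb ϑ W e := fun E =>
    Finset.prod_nonneg fun e _ => (edgeProb_mem_Icc hϑ hW e).1
  induction k generalizing E u with
  | zero =>
    by_cases huv : u = v
    · rw [walkWeight, if_pos huv, mul_one, ← configLaw_forall_open (μV := μV) (μE := μE) hϑ hW]
      exact measureReal_mono fun c hc => hc.1
    · have : trailEvent E 0 u v = ∅ := by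
        ext c
        simp only [Set.mem_empty_iff_false, iff_false]
        rintro ⟨-, p, -, hp, -⟩
        exact huv (SimpleGraph.Walk.eq_of_length_eq_zero hp)
      rw [this, measureReal_empty]
      exact mul_nonneg (hprod E) (walkWeight_nonneg hϑ hW _ _ _)
  | succ k ih =>
    have hsub : trailEvent E (k + 1) u v ⊆ ⋃ b ∈ (Finset.univ : Finset (Fin n)),
        {c | ∃ h : ¬ (s(u, b)).IsDiag, ⟨s(u, b), h⟩ ∉ E ∧
          c ∈ trailEvent (insert ⟨s(u, b), h⟩ E) k b v} := by
      rintro c ⟨hE, p, ht, hl, hav⟩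
      cases p with
      | nil => simp at hl
      | @cons _ b _ hadj p =>
        rw [SimpleGraph.Walk.isTrail_cons] at ht
        rw [SimpleGraph.Walk.length_cons] at hl
        simp only [SimpleGraph.Walk.edges_cons, List.mem_cons, not_or] at hav
        simp only [Set.mem_iUnion, Finset.mem_univ, exists_true_left]
        refine ⟨b, hadj.1, fun hmem => (hav _ hmem).1 rfl, ?_, p, ht.1, by omega, ?_⟩
        · intro e he
          rcases Finset.mem_insert.1 he with rfl | he
          · exact hadj.2
          · exact hE e he
        · intro e he
          rcases Finset.mem_insert.1 he with rfl | he
          · exact ht.2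
          · exact (hav e he).2
    refine (measureReal_mono hsub (measure_ne_top _ _)).trans
      ((measureReal_biUnion_finset_le _ _).trans ?_)
    rw [walkWeight, Finset.mul_sum]
    refine Finset.sum_le_sum fun b _ => ?_
    have hnn : 0 ≤ (∏ e ∈ E, edgeProb ϑ W e) *
        (W u * W b / (n * ϑ) * walkWeight ϑ W k b v) :=
      mul_nonneg (hprod E) (mul_nonneg (div_nonneg (mul_pos (hW u) (hW b)).le (by positivity))
        (walkWeight_nonneg hϑ hW _ _ _))
    by_cases hd : (s(u, b)).IsDiag
    · simpa [hd] using hnn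
    by_cases hmem : (⟨s(u, b), hd⟩ : Edge n) ∈ E
    · simpa [hd, hmem] using hnn
    refine (measureReal_mono (s₂ := trailEvent (insert ⟨s(u, b), hd⟩ E) k b v)
      (fun c hc => hc.2.2) (measure_ne_top _ _)).trans ((ih _ b).trans ?_)
    rw [Finset.prod_insert hmem, mul_comm (edgeProb ϑ W _), mul_assoc]
    exact mul_le_mul_of_nonneg_left (mul_le_mul_of_nonneg_right (edgeProb_le u b hd)
      (walkWeight_nonneg hϑ hW _ _ _)) (hprod E)

end Trails

/-! ### Probability of touching a vertex. -/

section Touch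

variable {n : ℕ} {ϑ : ℝ} {μV μE : Measure ℝ} [IsProbabilityMeasure μV] [IsProbabilityMeasure μE]
  {W : Fin n → ℝ} {F : Set (Site n)} {ℓ : ℕ} {v a : Fin n} {ζ : Noise n}

/-- The vertices within distance `ℓ` of `v` in the graph or in the perturbed graph. -/
def jointBall (F : Set (Site n)) (ℓ : ℕ) (v : Fin n) (ζ : Noise n) : Set (Fin n) :=
  ballVerts ℓ v ζ.1 ∪ ballVerts ℓ v (perturb F ζ)

/-- The vertices that lie in the joint ball of radius `ℓ`, or that are joined to a vertex of a
smaller joint ball by an edge which is open in one of the two copies. -/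
def touched (F : Set (Site n)) (ℓ : ℕ) (v : Fin n) (ζ : Noise n) : Set (Fin n) :=
  jointBall F ℓ v ζ ∪ {a | ∃ b, ∃ k < ℓ, b ∈ jointBall F k v ζ ∧
    ∃ h : ¬ (s(a, b)).IsDiag, ζ.1.1 ⟨s(a, b), h⟩ = true ∨ ζ.2.1 ⟨s(a, b), h⟩ = true}

theorem perturb_empty (ζ : Noise n) : perturb ∅ ζ = ζ.1 := by
  simp [perturb]

theorem perturb_fst_eq_or (F : Set (Site n)) (ζ : Noise n) (e : Edge n) :
    (perturb F ζ).1 e = ζ.1.1 e ∨ (perturb F ζ).1 e = ζ.2.1 e := by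
  by_cases h : Sum.inr e ∈ F <;> simp [perturb, h]

/-- A vertex `a ≠ v` joined by an edge of either copy to the ball around `v` in a perturbed graph
has an edge open in one of the two copies that continues by a trail to `v` avoiding this edge. -/
theorem exists_trail_of_edge {b : Fin n} {k : ℕ} (hav : a ≠ v)
    (hb : b ∈ ballVerts k v (perturb F ζ))
    (h : ¬ (s(a, b)).IsDiag) (ho : ζ.1.1 ⟨s(a, b), h⟩ = true ∨ ζ.2.1 ⟨s(a, b), h⟩ = true) :
    ∃ j ≤ k, ∃ b, ∃ h : ¬ (s(a, b)).IsDiag,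
      (ζ.1.1 ⟨s(a, b), h⟩ = true ∨ ζ.2.1 ⟨s(a, b), h⟩ = true) ∧
      ∃ p : (graph (perturb F ζ)).Walk b v, p.IsTrail ∧ p.length = j ∧ s(a, b) ∉ p.edges := by
  classical
  obtain ⟨p, hp, hl⟩ := hb
  by_cases he : s(a, b) ∈ p.edges
  -- If the path already uses the edge, it visits `a`; the initial piece up to `a`, reversed, starts
  -- at `a` with an edge that its remainder avoids.
  · have ha : a ∈ p.support := p.fst_mem_support_of_mem_edges he
    have hq := (hp.takeUntil ha).reverse
    have hql : (p.takeUntil a ha).reverse.length ≤ k := by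
      rw [SimpleGraph.Walk.length_reverse]
      exact (p.length_takeUntil_le_length ha).trans hl
    revert hq hql
    generalize (p.takeUntil a ha).reverse = q
    intro hq hql
    cases q with
    | nil => exact absurd rfl hav
    | @cons _ b' _ hadj q =>
      have ht := hq.isTrail
      rw [SimpleGraph.Walk.isTrail_cons] at ht
      rw [SimpleGraph.Walk.length_cons] at hql
      refine ⟨q.length, by omega, b', hadj.1, ?_, q, ht.1, rfl, ht.2⟩
      have := hadj.2
      rcases perturb_fst_eq_or F ζ ⟨s(a, b'), hadj.1⟩ with h | h <;> rw [h] at this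
      · exact Or.inl this
      · exact Or.inr this
  · exact ⟨p.length, hl, b, h, ho, p.reverse, hp.isTrail.reverse, by simp, by simpa using he⟩

/-- The first edge may be open in a copy that the graph carrying the trail does not use there.
Adding this edge to `F₀` or removing it selects the right copy; the trail avoids the edge and
survives, so everything happens in one perturbed configuration. -/
theorem exists_trailEvent_of_mem_touched (hav : a ≠ v) (ha : a ∈ touched F ℓ v ζ) :
    ∃ j < ℓ, ∃ b, ∃ h : ¬ (s(a, b)).IsDiag, ∃ F₀ ∈ ({∅, F} : Set (Set (Site n))),
      (perturb (insert (Sum.inr ⟨s(a, b), h⟩) F₀) ζ ∈ trailEvent {⟨s(a, b), h⟩} j b v ∨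
        perturb (F₀ \ {Sum.inr ⟨s(a, b), h⟩}) ζ ∈ trailEvent {⟨s(a, b), h⟩} j b v) := by
  have main : ∃ F₀ ∈ ({∅, F} : Set (Set (Site n))), ∃ k < ℓ, ∃ b ∈ ballVerts k v (perturb F₀ ζ),
      ∃ h : ¬ (s(a, b)).IsDiag, ζ.1.1 ⟨s(a, b), h⟩ = true ∨ ζ.2.1 ⟨s(a, b), h⟩ = true := by
    have hball : ∀ F₀ : Set (Site n), a ∈ ballVerts ℓ v (perturb F₀ ζ) →
        ∃ k < ℓ, ∃ b ∈ ballVerts k v (perturb F₀ ζ),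
          ∃ h : ¬ (s(a, b)).IsDiag, ζ.1.1 ⟨s(a, b), h⟩ = true ∨ ζ.2.1 ⟨s(a, b), h⟩ = true := by
      rintro F₀ ⟨p, -, hl⟩
      have hrl : p.reverse.length ≤ ℓ := by simpa using hl
      revert hrl
      generalize p.reverse = q
      intro hq
      cases q with
      | nil => exact absurd rfl hav
      | @cons _ b _ hadj q =>
        rw [SimpleGraph.Walk.length_cons] at hq
        refine ⟨q.length, hq, b, mem_ballVerts_iff.2 ⟨q.reverse, by simp⟩, hadj.1, ?_⟩
        have := hadj.2
        rcases perturb_fst_eq_or F₀ ζ ⟨s(a, b), hadj.1⟩ with h | h <;> rw [h] at this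
        · exact Or.inl this
        · exact Or.inr this
    rcases ha with (ha | ha) | ⟨b, k, hk, hb, ho⟩
    · rw [← perturb_empty ζ] at ha
      exact ⟨∅, by simp, hball ∅ ha⟩
    · exact ⟨F, by simp, hball F ha⟩
    · rcases hb with hb | hb
      · rw [← perturb_empty ζ] at hb
        exact ⟨∅, by simp, k, hk, b, hb, ho⟩
      · exact ⟨F, by simp, k, hk, b, hb, ho⟩
  obtain ⟨F₀, hF₀, k, hk, b, hb, h, ho⟩ := main
  obtain ⟨j, hj, b, h, ho, p, ht, hl, he⟩ := exists_trail_of_edge hav hb h ho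
  refine ⟨j, by omega, b, h, F₀, hF₀, ?_⟩
  have transfer : ∀ F₁ : Set (Site n), (perturb F₁ ζ).1 ⟨s(a, b), h⟩ = true →
      (∀ e : Edge n, e ≠ ⟨s(a, b), h⟩ → (Sum.inr e ∈ F₁ ↔ Sum.inr e ∈ F₀)) →
      perturb F₁ ζ ∈ trailEvent {⟨s(a, b), h⟩} j b v := by
    intro F₁ ho hF
    have hpe : ∀ e ∈ p.edges, e ∈ (graph (perturb F₁ ζ)).edgeSet := by
      intro e hep
      have hG := p.edges_subset_edgeSet hep
      have hd : ¬ e.IsDiag := SimpleGraph.not_isDiag_of_mem_edgeSet _ hG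
      have h1 := (mem_edgeSet_graph (e := ⟨e, hd⟩)).1 hG
      refine (mem_edgeSet_graph (e := ⟨e, hd⟩)).2 ?_
      have hne : (⟨e, hd⟩ : Edge n) ≠ ⟨s(a, b), h⟩ := by
        rintro heq
        exact he (Subtype.mk.inj heq ▸ hep)
      have hiff := hF _ hne
      by_cases hm : Sum.inr ⟨e, hd⟩ ∈ F₀
      · simpa [perturb, hm, hiff.2 hm] using h1
      · simpa [perturb, hm, mt hiff.1 hm] using h1
    refine ⟨by simpa using ho, p.transfer _ hpe, ?_, by simpa using hl, by simpa using he⟩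
    rw [SimpleGraph.Walk.isTrail_def, SimpleGraph.Walk.edges_transfer]
    exact ht.edges_nodup
  rcases ho with ho | ho
  · refine Or.inr (transfer _ (by simpa [perturb] using ho) fun e hne => ?_)
    simp [hne]
  · refine Or.inl (transfer _ (by simpa [perturb] using ho) fun e hne => ?_)
    simp [hne]

/-- The factor 4 counts two graphs for the trail times two copies for its first edge. -/
theorem noiseLaw_mem_touched_le (hϑ : 0 < ϑ) (hW : ∀ u, 0 < W u) (hav : a ≠ v) :
    (noiseLaw ϑ μV μE W).real {ζ | a ∈ touched F ℓ v ζ} ≤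
      4 * (W a * W v / (n * ϑ) * ∑ j ∈ Finset.range ℓ, Gam ϑ W 2 ^ j) := by
  classical
  let T : Set (Site n) → ℕ → Fin n → Set (Noise n) := fun F₀ j b =>
    {ζ | ∃ h : ¬ (s(a, b)).IsDiag,
      perturb (insert (Sum.inr ⟨s(a, b), h⟩) F₀) ζ ∈ trailEvent {⟨s(a, b), h⟩} j b v} ∪
    {ζ | ∃ h : ¬ (s(a, b)).IsDiag,
      perturb (F₀ \ {Sum.inr ⟨s(a, b), h⟩}) ζ ∈ trailEvent {⟨s(a, b), h⟩} j b v}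
  have hpre : ∀ (F₁ : Edge n → Set (Site n)) (j : ℕ) (b : Fin n),
      (noiseLaw ϑ μV μE W).real {ζ | ∃ h : ¬ (s(a, b)).IsDiag,
        perturb (F₁ ⟨s(a, b), h⟩) ζ ∈ trailEvent {⟨s(a, b), h⟩} j b v} ≤
      W a * W b / (n * ϑ) * walkWeight ϑ W j b v := by
    intro F₁ j b
    by_cases hd : (s(a, b)).IsDiag
    · have : 0 ≤ W a * W b / (n * ϑ) * walkWeight ϑ W j b v :=
        mul_nonneg (div_nonneg (mul_pos (hW a) (hW b)).le (by positivity))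
          (walkWeight_nonneg hϑ hW _ _ _)
      simpa [hd] using this
    · have hms : MeasurableSet (trailEvent {⟨s(a, b), hd⟩} j b v) := by
        refine measurableSet_setOfPred.2 (measurable_comp_indicators fun c c' h => ?_)
        obtain ⟨x, w⟩ := c
        obtain ⟨x', w'⟩ := c'
        obtain rfl : x = x' := h
        rfl
      refine (measureReal_mono (s₂ := perturb (F₁ ⟨s(a, b), hd⟩) ⁻¹'
        trailEvent {⟨s(a, b), hd⟩} j b v) (fun ζ hζ => hζ.2)
        (measure_ne_top _ _)).trans ?_
      rw [(measurePreserving_perturb _).measureReal_preimage hms.nullMeasurableSet]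
      refine (configLaw_trailEvent_le hϑ hW _ _ _ _).trans ?_
      rw [Finset.prod_singleton]
      exact mul_le_mul_of_nonneg_right (edgeProb_le a b hd) (walkWeight_nonneg hϑ hW _ _ _)
  have hT : ∀ F₀ j b, (noiseLaw ϑ μV μE W).real (T F₀ j b) ≤
      2 * (W a * W b / (n * ϑ) * walkWeight ϑ W j b v) := by
    intro F₀ j b
    refine (measureReal_union_le _ _).trans ?_
    rw [two_mul]
    exact add_le_add (hpre (fun e => insert (Sum.inr e) F₀) j b)
      (hpre (fun e => F₀ \ {Sum.inr e}) j b)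
  have hsub : {ζ | a ∈ touched F ℓ v ζ} ⊆ ⋃ j ∈ Finset.range ℓ,
      ⋃ b ∈ (Finset.univ : Finset (Fin n)), (T ∅ j b ∪ T F j b) := by
    intro ζ hζ
    obtain ⟨j, hj, b, h, F₀, hF₀, hmem⟩ := exists_trailEvent_of_mem_touched hav hζ
    simp only [Set.mem_iUnion, Finset.mem_univ, Finset.mem_range, exists_true_left]
    refine ⟨j, hj, b, ?_⟩
    rcases hF₀ with rfl | rfl
    · exact Or.inl (hmem.imp (fun hm => ⟨h, hm⟩) (fun hm => ⟨h, hm⟩))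
    · exact Or.inr (hmem.imp (fun hm => ⟨h, hm⟩) (fun hm => ⟨h, hm⟩))
  refine (measureReal_mono hsub (measure_ne_top _ _)).trans
    ((measureReal_biUnion_finset_le _ _).trans ?_)
  rw [Finset.mul_sum, Finset.mul_sum]
  refine Finset.sum_le_sum fun j _ => (measureReal_biUnion_finset_le _ _).trans ?_
  -- The first edge and a trail of length `j` form a sequence of length `j + 1`.
  rw [← walkWeight_succ_eq, walkWeight, Finset.mul_sum]
  refine Finset.sum_le_sum fun b _ => (measureReal_union_le _ _).trans ?_
  linarith [hT ∅ j b, hT F j b]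

end Touch

/-! ### Covariance bounds by resampling. -/

section Covariance

variable {X : Type*} [MeasurableSpace X] {P : Measure X} [IsProbabilityMeasure P]

theorem integrable_of_abs_le_one {f : X → ℝ} (hf : Measurable f) (h : ∀ x, |f x| ≤ 1) :
    Integrable f P :=
  Integrable.of_bound hf.aestronglyMeasurable 1 (Filter.Eventually.of_forall h)

theorem covariance_eq_sub_of_abs_le_one {f g : X → ℝ} (hf : Measurable f) (hg : Measurable g)
    (hf1 : ∀ x, |f x| ≤ 1) (hg1 : ∀ x, |g x| ≤ 1) :
    cov[f, g; P] = ∫ x, f x * g x ∂P - (∫ x, f x ∂P) * ∫ x, g x ∂P :=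
  covariance_eq_sub
    (MemLp.of_bound hf.aestronglyMeasurable 1 (Filter.Eventually.of_forall hf1))
    (MemLp.of_bound hg.aestronglyMeasurable 1 (Filter.Eventually.of_forall hg1))

/-- Expand `0 ≤ Var (f - g)`; both variances are at most one. -/
theorem covariance_le_one {f g : X → ℝ} (hf : Measurable f) (hg : Measurable g)
    (hf1 : ∀ x, |f x| ≤ 1) (hg1 : ∀ x, |g x| ≤ 1) : cov[f, g; P] ≤ 1 := by
  have hvar : ∀ {h : X → ℝ}, Measurable h → (∀ x, |h x| ≤ 1) → variance h P ≤ 1 := by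
    intro h hh hh1
    refine (variance_le_expectation_sq hh.aestronglyMeasurable).trans ?_
    have hsq : ∀ x, h x ^ 2 ≤ 1 := fun x => (sq_le_one_iff_abs_le_one _).2 (hh1 x)
    have hle : ∫ x, (h ^ 2) x ∂P ≤ ∫ _, (1 : ℝ) ∂P := by
      refine integral_mono (integrable_of_abs_le_one (hh.pow_const 2) fun x => ?_)
        (integrable_const 1) hsq
      rw [Pi.pow_apply, abs_of_nonneg (sq_nonneg _)]
      exact hsq x
    simpa using hle
  have hfL : MemLp f 2 P :=
    MemLp.of_bound hf.aestronglyMeasurable 1 (Filter.Eventually.of_forall hf1)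
  have hgL : MemLp g 2 P :=
    MemLp.of_bound hg.aestronglyMeasurable 1 (Filter.Eventually.of_forall hg1)
  have h := variance_sub hfL hgL
  have h0 := variance_nonneg (f - g) P
  linarith [hvar hf hf1, hvar hg hg1]

/-- Let `S` be a random element of a finite set such that `M s` resamples `P` without changing
`f` and the event `S = s`. Then the covariance of `f` and `g` is controlled by the probability
that resampling according to `S` changes the value of `g` at the independent copy. -/
theorem covariance_le_of_resampling {σ : Type*} [Finite σ] {S : X → σ} {M : σ → X × X → X}
    {f g : X → ℝ} {bad : Set (X × X)} (hS : ∀ s, MeasurableSet {x | S x = s})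
    (hM : ∀ s, MeasurePreserving (M s) (P.prod P) P)
    (hf : Measurable f) (hg : Measurable g) (hf1 : ∀ x, |f x| ≤ 1) (hg1 : ∀ x, |g x| ≤ 1)
    (hbad : MeasurableSet bad) (hSM : ∀ s p, S (M s p) = s ↔ S p.1 = s)
    (hfM : ∀ p, f (M (S p.1) p) = f p.1) (hgM : ∀ p, p ∉ bad → g (M (S p.1) p) = g p.2) :
    cov[f, g; P] ≤ 2 * (P.prod P).real bad := by
  classical
  have := Fintype.ofFinite σ
  -- `M s` preserves the measure only for fixed `s`, so the integral is split by the value of `S`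
  -- before resampling; `hSM` then makes the pieces reassemble with the random index `S p.1`.
  let φ : σ → X → ℝ := fun s => Set.indicator {x | S x = s} fun x => f x * g x
  have hfg : Integrable (fun x => f x * g x) P :=
    integrable_of_abs_le_one (hf.mul hg) fun x => by
      rw [abs_mul]; exact mul_le_one₀ (hf1 x) (abs_nonneg _) (hg1 x)
  have hφ : ∀ s, Integrable (φ s) P := fun s => hfg.indicator (hS s)
  have hsum : ∀ x, ∑ s, φ s x = f x * g x := by
    intro x
    simp [φ, Set.indicator_apply]
  have hsumM : ∀ p, ∑ s, φ s (M s p) = f p.1 * g (M (S p.1) p) := by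
    intro p
    simp only [φ, Set.indicator_apply, Set.mem_ofPred_eq, hSM]
    rw [Finset.sum_ite_eq]
    simp [hfM]
  have hφM : ∀ s, Integrable (fun p => φ s (M s p)) (P.prod P) := fun s =>
    (hM s).integrable_comp_of_integrable (hφ s)
  have hIM : Integrable (fun p : X × X => f p.1 * g (M (S p.1) p)) (P.prod P) := by
    simp_rw [← hsumM]
    exact integrable_finsetSum _ fun s _ => hφM s
  have hI : ∫ x, f x * g x ∂P = ∫ p, f p.1 * g (M (S p.1) p) ∂(P.prod P) := by
    simp_rw [← hsumM, ← hsum]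
    rw [integral_finsetSum _ fun s _ => hφ s, integral_finsetSum _ fun s _ => hφM s]
    refine Finset.sum_congr rfl fun s _ => ?_
    rw [← (hM s).map_eq, integral_map (hM s).measurable.aemeasurable, (hM s).map_eq]
    rw [(hM s).map_eq]
    exact (hφ s).aestronglyMeasurable
  have hI2 : Integrable (fun p : X × X => f p.1 * g p.2) (P.prod P) :=
    (integrable_of_abs_le_one hf hf1).mul_prod (integrable_of_abs_le_one hg hg1)
  rw [covariance_eq_sub_of_abs_le_one hf hg hf1 hg1, hI, ← integral_prod_mul,
    ← integral_sub hIM hI2]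
  have hle : ∫ p, (f p.1 * g (M (S p.1) p) - f p.1 * g p.2) ∂(P.prod P) ≤
      ∫ p, bad.indicator (fun _ => (2 : ℝ)) p ∂(P.prod P) := by
    refine integral_mono (hIM.sub hI2) ((integrable_const 2).indicator hbad) fun p => ?_
    by_cases hp : p ∈ bad
    · simp only [Set.indicator_of_mem hp]
      have h1 : |f p.1 * g (M (S p.1) p)| ≤ 1 := by
        rw [abs_mul]; exact mul_le_one₀ (hf1 _) (abs_nonneg _) (hg1 _)
      have h2 : |f p.1 * g p.2| ≤ 1 := by
        rw [abs_mul]; exact mul_le_one₀ (hf1 _) (abs_nonneg _) (hg1 _)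
      linarith [(abs_le.1 h1).2, (abs_le.1 h2).1]
    · simp [Set.indicator_of_notMem hp, hgM p hp]
  refine hle.trans_eq ?_
  rw [integral_indicator_const _ hbad, smul_eq_mul, mul_comm]

end Covariance

/-! ### The explored set and its resampling. -/

section Exploration

variable {n m m' ℓ : ℕ} {F F' : Set (Site n)} {v : Fin m → Fin n} {v' : Fin m' → Fin n}
  {ζ ζ' : Noise n}

/-- The sites explored when revealing the `ℓ`-neighbourhoods of the `v i` in the graph and in the
perturbed graph. -/
def explored (F : Set (Site n)) (ℓ : ℕ) (v : Fin m → Fin n) (ζ : Noise n) : Set (Site n) :=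
  {z | Sum.elim (fun u => ∃ i, u ∈ jointBall F ℓ (v i) ζ)
    (fun e => ∃ i, ∃ u ∈ e.1, ∃ k < ℓ, u ∈ jointBall F k (v i) ζ) z}

theorem inl_mem_explored {u : Fin n} :
    Sum.inl u ∈ explored F ℓ v ζ ↔ ∃ i, u ∈ jointBall F ℓ (v i) ζ := Iff.rfl

theorem inr_mem_explored {e : Edge n} :
    Sum.inr e ∈ explored F ℓ v ζ ↔ ∃ i, ∃ u ∈ e.1, ∃ k < ℓ, u ∈ jointBall F k (v i) ζ := Iff.rfl

theorem jointBall_mono {k : ℕ} {u : Fin n} (h : k ≤ ℓ) : jointBall F k u ζ ⊆ jointBall F ℓ u ζ :=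
  Set.union_subset_union (ballVerts_mono h) (ballVerts_mono h)

theorem perturb_fst_congr {e : Edge n} (h : ζ.1.1 e = ζ'.1.1 e ∧ ζ.2.1 e = ζ'.2.1 e) :
    (perturb F ζ).1 e = (perturb F ζ').1 e := by
  simp only [perturb, h.1, h.2]

theorem perturb_snd_congr {z : Site n} (h : ζ.1.2 z = ζ'.1.2 z ∧ ζ.2.2 z = ζ'.2.2 z) :
    (perturb F ζ).2 z = (perturb F ζ').2 z := by
  simp only [perturb, h.1, h.2]

section Congr

variable {u : Fin n}

theorem ballVerts_subset_jointBall {F₀ : Set (Site n)} (hF₀ : F₀ = ∅ ∨ F₀ = F) (k : ℕ) :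
    ballVerts k u (perturb F₀ ζ) ⊆ jointBall F k u ζ := by
  rcases hF₀ with rfl | rfl
  · rw [perturb_empty]; exact Set.subset_union_left
  · exact Set.subset_union_right

theorem agreeNear_perturb
    (hX : ∀ e : Edge n, ∀ a ∈ e.1, ∀ k < ℓ, a ∈ jointBall F k u ζ →
      ζ.1.1 e = ζ'.1.1 e ∧ ζ.2.1 e = ζ'.2.1 e)
    {F₀ : Set (Site n)} (hF₀ : F₀ = ∅ ∨ F₀ = F) :
    AgreeNear ℓ u (perturb F₀ ζ) (perturb F₀ ζ') := fun e a ha k hk hb =>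
  perturb_fst_congr (hX e a ha k hk (ballVerts_subset_jointBall hF₀ k hb))

theorem jointBall_congr
    (hX : ∀ e : Edge n, ∀ a ∈ e.1, ∀ k < ℓ, a ∈ jointBall F k u ζ →
      ζ.1.1 e = ζ'.1.1 e ∧ ζ.2.1 e = ζ'.2.1 e) {k : ℕ} (hk : k ≤ ℓ) :
    jointBall F k u ζ = jointBall F k u ζ' := by
  have h0 := (agreeNear_perturb hX (Or.inl rfl)).ballVerts_eq hk
  rw [perturb_empty, perturb_empty] at h0
  rw [jointBall, jointBall, h0, (agreeNear_perturb hX (Or.inr rfl)).ballVerts_eq hk]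

/-- Weights of edges closed in both copies are left free in `hE`, since such edges lie in no
neighbourhood. This matters for edges between the two explorations, whose weights the merge takes
from the other noise. -/
theorem nbhd_pair_congr
    (hX : ∀ e : Edge n, ∀ a ∈ e.1, ∀ k < ℓ, a ∈ jointBall F k u ζ →
      ζ.1.1 e = ζ'.1.1 e ∧ ζ.2.1 e = ζ'.2.1 e)
    (hV : ∀ a ∈ jointBall F ℓ u ζ,
      ζ.1.2 (Sum.inl a) = ζ'.1.2 (Sum.inl a) ∧ ζ.2.2 (Sum.inl a) = ζ'.2.2 (Sum.inl a))
    (hE : ∀ e : Edge n, ∀ a ∈ e.1, ∀ k < ℓ, a ∈ jointBall F k u ζ →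
      (ζ.1.1 e = true ∨ ζ.2.1 e = true) →
      ζ.1.2 (Sum.inr e) = ζ'.1.2 (Sum.inr e) ∧ ζ.2.2 (Sum.inr e) = ζ'.2.2 (Sum.inr e)) :
    (nbhd ℓ u ζ.1, nbhd ℓ u (perturb F ζ)) = (nbhd ℓ u ζ'.1, nbhd ℓ u (perturb F ζ')) := by
  have key : ∀ F₀ : Set (Site n), (F₀ = ∅ ∨ F₀ = F) →
      nbhd ℓ u (perturb F₀ ζ) = nbhd ℓ u (perturb F₀ ζ') := by
    intro F₀ hF₀
    refine (agreeNear_perturb hX hF₀).nbhd_eq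
      (fun a ha => perturb_snd_congr (hV a (ballVerts_subset_jointBall hF₀ ℓ ha)))
      (fun e he => perturb_snd_congr ?_)
    obtain ⟨a, ha, k, hk, hb⟩ := exists_mem_of_mem_ballEdges he
    refine hE e a ha k hk (ballVerts_subset_jointBall hF₀ k hb) ?_
    have ho := open_of_mem_ballEdges he
    rcases perturb_fst_eq_or F₀ ζ e with h | h <;> rw [h] at ho
    · exact Or.inl ho
    · exact Or.inr ho
  have h0 := key ∅ (Or.inl rfl)
  rw [perturb_empty, perturb_empty] at h0
  rw [h0, key F (Or.inr rfl)]

end Congr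

/-- The two noises have the same data at every site of `s`. -/
def AgreeOn (s : Set (Site n)) (ζ ζ' : Noise n) : Prop :=
  (∀ e : Edge n, Sum.inr e ∈ s → ζ.1.1 e = ζ'.1.1 e ∧ ζ.2.1 e = ζ'.2.1 e) ∧
    ∀ z ∈ s, ζ.1.2 z = ζ'.1.2 z ∧ ζ.2.2 z = ζ'.2.2 z

theorem AgreeOn.symm {s : Set (Site n)} (h : AgreeOn s ζ ζ') : AgreeOn s ζ' ζ :=
  ⟨fun e he => ⟨(h.1 e he).1.symm, (h.1 e he).2.symm⟩,
    fun z hz => ⟨(h.2 z hz).1.symm, (h.2 z hz).2.symm⟩⟩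

theorem agreeOn_merge (s : Set (Site n)) (p : Noise n × Noise n) : AgreeOn s p.1 (merge s p) :=
  ⟨fun e he => by simp [merge, perturb, he], fun z hz => by simp [merge, perturb, hz]⟩

theorem agreeOn_compl_merge (s : Set (Site n)) (p : Noise n × Noise n) :
    AgreeOn sᶜ p.2 (merge s p) := by
  refine ⟨fun e he => ?_, fun z hz => ?_⟩
  · rw [Set.mem_compl_iff] at he
    simp [merge, perturb, he]
  · rw [Set.mem_compl_iff] at hz
    simp [merge, perturb, hz]

theorem AgreeOn.indicators (h : AgreeOn (explored F ℓ v ζ) ζ ζ') (i : Fin m) :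
    ∀ e : Edge n, ∀ a ∈ e.1, ∀ k < ℓ, a ∈ jointBall F k (v i) ζ →
      ζ.1.1 e = ζ'.1.1 e ∧ ζ.2.1 e = ζ'.2.1 e := fun e a ha k hk hb =>
  h.1 e (inr_mem_explored.2 ⟨i, a, ha, k, hk, hb⟩)

/-- The stopping-set property: whether exploration continues past an edge is decided by data already
revealed. -/
theorem AgreeOn.explored_eq (h : AgreeOn (explored F ℓ v ζ) ζ ζ') :
    explored F ℓ v ζ = explored F ℓ v ζ' := by
  have hb : ∀ i, ∀ k ≤ ℓ, jointBall F k (v i) ζ = jointBall F k (v i) ζ' := fun i k hk =>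
    jointBall_congr (h.indicators i) hk
  ext z
  cases z with
  | inl u =>
    rw [inl_mem_explored, inl_mem_explored]
    exact exists_congr fun i => by rw [hb i ℓ le_rfl]
  | inr e =>
    rw [inr_mem_explored, inr_mem_explored]
    refine exists_congr fun i => exists_congr fun a => and_congr_right fun _ =>
      exists_congr fun k => and_congr_right fun hk => ?_
    rw [hb i k hk.le]

theorem AgreeOn.nbhds_eq (h : AgreeOn (explored F ℓ v ζ) ζ ζ') :
    nbhds ℓ F v ζ = nbhds ℓ F v ζ' :=
  funext fun i => nbhd_pair_congr (h.indicators i)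
    (fun _ ha => h.2 _ (inl_mem_explored.2 ⟨i, ha⟩))
    (fun _ a ha k hk hb _ => h.2 _ (inr_mem_explored.2 ⟨i, a, ha, k, hk, hb⟩))

theorem explored_merge_iff (s : Set (Site n)) (p : Noise n × Noise n) :
    explored F ℓ v (merge s p) = s ↔ explored F ℓ v p.1 = s := by
  constructor
  · intro h
    have hagree : AgreeOn (explored F ℓ v (merge s p)) (merge s p) p.1 := by
      rw [h]
      exact (agreeOn_merge s p).symm
    exact hagree.explored_eq.symm.trans h
  · rintro rfl
    exact (agreeOn_merge _ p).explored_eq.symm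

/-- An open edge reached by both explorations would make the far endpoint touched from the near
root, contradicting disjointness. -/
theorem closed_of_disjoint {i : Fin m} {i' : Fin m'}
    (hd : Disjoint (touched F ℓ (v i) ζ) (touched F' ℓ (v' i') ζ')) {e : Edge n} {a b : Fin n}
    {j k : ℕ} (ha : a ∈ e.1) (hj : j < ℓ) (hav : a ∈ jointBall F j (v i) ζ)
    (hb : b ∈ e.1) (hk : k < ℓ) (hbv : b ∈ jointBall F' k (v' i') ζ') :
    ¬ (ζ.1.1 e = true ∨ ζ.2.1 e = true) ∧ ¬ (ζ'.1.1 e = true ∨ ζ'.2.1 e = true) := by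
  have ha' : a ∈ touched F ℓ (v i) ζ := Or.inl (jointBall_mono hj.le hav)
  have hb' : b ∈ touched F' ℓ (v' i') ζ' := Or.inl (jointBall_mono hk.le hbv)
  have hne : a ≠ b := by
    rintro rfl
    exact Set.disjoint_left.1 hd ha' hb'
  obtain ⟨e, hed⟩ := e
  obtain rfl : e = s(a, b) := ((Sym2.mem_and_mem_iff hne).1 ⟨ha, hb⟩)
  have hed' : ¬ (s(b, a)).IsDiag := by rwa [Sym2.eq_swap]
  have hswap : (⟨s(a, b), hed⟩ : Edge n) = ⟨s(b, a), hed'⟩ := Subtype.ext Sym2.eq_swap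
  constructor
  · intro ho
    rw [hswap] at ho
    exact Set.disjoint_left.1 hd (Or.inr ⟨a, j, hj, hav, hed', ho⟩) hb'
  · intro ho
    exact Set.disjoint_left.1 hd ha' (Or.inr ⟨b, k, hk, hbv, hed, ho⟩)

theorem nbhds_merge_of_disjoint (p : Noise n × Noise n)
    (hd : ∀ i i', Disjoint (touched F ℓ (v i) p.1) (touched F' ℓ (v' i') p.2)) :
    nbhds ℓ F' v' (merge (explored F ℓ v p.1) p) = nbhds ℓ F' v' p.2 := by
  set s := explored F ℓ v p.1 with hs
  refine funext fun i' => (nbhd_pair_congr ?_ ?_ ?_).symm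
  · intro e b hb k hk hbv
    -- On `s` the merge shows `p.1` instead of `p.2`, but an edge met by both explorations is closed
    -- in both noises.
    by_cases he : Sum.inr e ∈ s
    · obtain ⟨i, a, ha, j, hj, hav⟩ := inr_mem_explored.1 he
      obtain ⟨h1, h2⟩ := closed_of_disjoint (hd i i') ha hj hav hb hk hbv
      obtain ⟨h3, h4⟩ := (agreeOn_merge s p).1 e he
      simp only [not_or, Bool.not_eq_true] at h1 h2
      exact ⟨by rw [h2.1, ← h3, h1.1], by rw [h2.2, ← h4, h1.2]⟩
    · exact (agreeOn_compl_merge s p).1 e he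
  · intro a ha
    refine (agreeOn_compl_merge s p).2 _ fun hmem => ?_
    obtain ⟨i, hi⟩ := inl_mem_explored.1 hmem
    exact Set.disjoint_left.1 (hd i i') (Or.inl hi) (Or.inl ha)
  · intro e b hb k hk hbv ho
    refine (agreeOn_compl_merge s p).2 _ fun hmem => ?_
    obtain ⟨i, a, ha, j, hj, hav⟩ := inr_mem_explored.1 hmem
    exact (closed_of_disjoint (hd i i') ha hj hav hb hk hbv).2 ho

theorem measurable_comp_noise_indicators {α : Type*} [MeasurableSpace α] {f : Noise n → α}
    (hf : ∀ (x x' : Edge n → Bool) (w w' : Site n → ℝ),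
      f ((x, w), (x', w')) = f ((x, 0), (x', 0))) : Measurable f := by
  have : f = (fun q : (Edge n → Bool) × (Edge n → Bool) => f ((q.1, 0), (q.2, 0))) ∘
      fun ζ => (ζ.1.1, ζ.2.1) := by
    funext ζ; exact hf _ _ _ _
  rw [this]
  exact (Measurable.of_discrete).comp (by fun_prop)

theorem measurableSet_mem_touched (u a : Fin n) :
    MeasurableSet {ζ : Noise n | a ∈ touched F ℓ u ζ} :=
  measurableSet_setOfPred.2 (measurable_comp_noise_indicators fun _ _ _ _ => rfl)

theorem measurableSet_explored_eq (s : Set (Site n)) :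
    MeasurableSet {ζ : Noise n | explored F ℓ v ζ = s} :=
  measurableSet_setOfPred.2 (measurable_comp_noise_indicators fun _ _ _ _ => rfl)

end Exploration

/-! ### Summation and the constant. -/

section Bound

variable {n m m' ℓ : ℕ} {ϑ : ℝ} {μV μE : Measure ℝ} [IsProbabilityMeasure μV]
  [IsProbabilityMeasure μE] {W : Fin n → ℝ} {F F' : Set (Site n)} {v : Fin m → Fin n}
  {v' : Fin m' → Fin n}

theorem covariance_nbhds_le_touched
    {g : (Fin m → WeightedGraph n × WeightedGraph n) → ℝ}
    {g' : (Fin m' → WeightedGraph n × WeightedGraph n) → ℝ} (hg : Measurable g)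
    (hg' : Measurable g') (hg1 : ∀ b, |g b| ≤ 1) (hg1' : ∀ b, |g' b| ≤ 1) :
    cov[fun ζ => g (nbhds ℓ F v ζ), fun ζ => g' (nbhds ℓ F' v' ζ); noiseLaw ϑ μV μE W] ≤
      2 * ∑ i, ∑ i', ∑ a, (noiseLaw ϑ μV μE W).real {ζ | a ∈ touched F ℓ (v i) ζ} *
        (noiseLaw ϑ μV μE W).real {ζ | a ∈ touched F' ℓ (v' i') ζ} := by
  let bad : Set (Noise n × Noise n) :=
    ⋃ i ∈ (Finset.univ : Finset (Fin m)), ⋃ i' ∈ (Finset.univ : Finset (Fin m')),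
      ⋃ a ∈ (Finset.univ : Finset (Fin n)),
        {ζ | a ∈ touched F ℓ (v i) ζ} ×ˢ {ζ | a ∈ touched F' ℓ (v' i') ζ}
  have hbad : MeasurableSet bad :=
    Finset.measurableSet_biUnion _ fun i _ => Finset.measurableSet_biUnion _ fun i' _ =>
      Finset.measurableSet_biUnion _ fun a _ =>
        (measurableSet_mem_touched _ _).prod (measurableSet_mem_touched _ _)
  refine (covariance_le_of_resampling (S := explored F ℓ v) (M := merge) (bad := bad)
    measurableSet_explored_eq measurePreserving_merge (hg.comp (measurable_nbhds F v))
    (hg'.comp (measurable_nbhds F' v')) (fun _ => hg1 _) (fun _ => hg1' _) hbad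
    explored_merge_iff ?_ ?_).trans ?_
  · intro p
    rw [Function.comp_apply, Function.comp_apply,
      ← (agreeOn_merge (explored F ℓ v p.1) p).nbhds_eq]
  · intro p hp
    rw [Function.comp_apply, Function.comp_apply, nbhds_merge_of_disjoint p]
    intro i i'
    rw [Set.disjoint_left]
    intro a ha ha'
    refine hp ?_
    simp only [bad, Set.mem_iUnion, Finset.mem_univ, exists_true_left]
    exact ⟨i, i', a, ha, ha'⟩
  · refine mul_le_mul_of_nonneg_left ?_ zero_le_two
    refine (measureReal_biUnion_finset_le _ _).trans (Finset.sum_le_sum fun i _ => ?_)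
    refine (measureReal_biUnion_finset_le _ _).trans (Finset.sum_le_sum fun i' _ => ?_)
    refine (measureReal_biUnion_finset_le _ _).trans (Finset.sum_le_sum fun a _ => ?_)
    rw [measureReal_prod_prod]

/-- The two linear terms come from meeting at `a = u` or `a = u'`, where one probability is bounded
by one; the quadratic term is the sum over all `a`. -/
theorem sum_touched_le (hϑ : 0 < ϑ) (hW : ∀ u, 0 < W u) {u u' : Fin n} (huu : u ≠ u') :
    ∑ a, (noiseLaw ϑ μV μE W).real {ζ | a ∈ touched F ℓ u ζ} *
        (noiseLaw ϑ μV μE W).real {ζ | a ∈ touched F' ℓ u' ζ} ≤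
      W u * W u' / (n * ϑ) * (2 * (4 * ∑ j ∈ Finset.range ℓ, Gam ϑ W 2 ^ j) +
        (4 * ∑ j ∈ Finset.range ℓ, Gam ϑ W 2 ^ j) ^ 2 * Gam ϑ W 2) := by
  have hΓ : 0 ≤ Gam ϑ W 2 :=
    div_nonneg (Finset.sum_nonneg fun a _ => sq_nonneg _) (by positivity)
  set K : ℝ := 4 * ∑ j ∈ Finset.range ℓ, Gam ϑ W 2 ^ j with hK
  have hK0 : 0 ≤ K := mul_nonneg (by norm_num) (Finset.sum_nonneg fun j _ => pow_nonneg hΓ j)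
  have hr : ∀ a w : Fin n, 0 ≤ W a * W w / (n * ϑ) * K := fun a w =>
    mul_nonneg (div_nonneg (mul_pos (hW a) (hW w)).le (by positivity)) hK0
  have hP : ∀ (F : Set (Site n)) (a w : Fin n),
      (noiseLaw ϑ μV μE W).real {ζ | a ∈ touched F ℓ w ζ} ≤
        (if a = w then 1 else 0) + W a * W w / (n * ϑ) * K := by
    intro F a w
    split_ifs with h
    · linarith [hr a w, measureReal_le_one (μ := noiseLaw ϑ μV μE W)
        (s := {ζ | a ∈ touched F ℓ w ζ})]
    · refine (noiseLaw_mem_touched_le hϑ hW h).trans_eq ?_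
      rw [hK]; ring
  have hterm : ∀ a, (noiseLaw ϑ μV μE W).real {ζ | a ∈ touched F ℓ u ζ} *
        (noiseLaw ϑ μV μE W).real {ζ | a ∈ touched F' ℓ u' ζ} ≤
      ((if a = u then W u * W u' / (n * ϑ) * K else 0) +
        (if a = u' then W u * W u' / (n * ϑ) * K else 0)) +
        W u * W u' / (n * ϑ) * K ^ 2 * (W a ^ 2 / (n * ϑ)) := by
    intro a
    refine (mul_le_mul (hP F a u) (hP F' a u') measureReal_nonneg
      (add_nonneg (by split_ifs <;> norm_num) (hr a u))).trans_eq ?_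
    by_cases h : a = u
    · subst h
      simp only [if_pos, if_neg huu]
      ring
    · by_cases h' : a = u'
      · subst h'
        simp only [if_pos, if_neg h]
        ring
      · simp only [if_neg h, if_neg h']
        ring
  refine (Finset.sum_le_sum fun a _ => hterm a).trans_eq ?_
  rw [Finset.sum_add_distrib, Finset.sum_add_distrib, Finset.sum_ite_eq' Finset.univ u,
    Finset.sum_ite_eq' Finset.univ u', if_pos (Finset.mem_univ _), if_pos (Finset.mem_univ _),
    ← Finset.mul_sum, ← Finset.sum_div, ← Gam]
  ring

theorem geom_sum_le_one_add_pow {x : ℝ} (hx : 0 ≤ x) (t : ℕ) :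
    ∑ j ∈ Finset.range (t + 1), x ^ j ≤ (1 + x) ^ t := by
  induction t with
  | zero => simp
  | succ t ih =>
    rw [Finset.sum_range_succ', pow_zero]
    have h1 : ∑ j ∈ Finset.range (t + 1), x ^ (j + 1) = x * ∑ j ∈ Finset.range (t + 1), x ^ j := by
      rw [Finset.mul_sum]
      exact Finset.sum_congr rfl fun j _ => pow_succ' x j
    rw [h1, pow_succ]
    have h2 : 1 ≤ (1 + x) ^ t := one_le_pow₀ (by linarith)
    nlinarith [mul_le_mul_of_nonneg_left ih hx]

/-- With `ℓ = t + 1`, the power `2 * t` absorbs the squared geometric sum and the remaining cube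
absorbs `16 + 32 * x`. The constant 6 is not optimised. -/
theorem geom_bound {x : ℝ} (hx : 0 ≤ x) (ℓ : ℕ) :
    2 * (2 * (4 * ∑ j ∈ Finset.range ℓ, x ^ j) + (4 * ∑ j ∈ Finset.range ℓ, x ^ j) ^ 2 * x) ≤
      (x + 6) ^ (2 * ℓ + 1) := by
  cases ℓ with
  | zero => simp; linarith
  | succ t =>
    have hs := geom_sum_le_one_add_pow hx t
    have hs0 : 0 ≤ ∑ j ∈ Finset.range (t + 1), x ^ j :=
      Finset.sum_nonneg fun j _ => pow_nonneg hx j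
    generalize ∑ j ∈ Finset.range (t + 1), x ^ j = S at hs hs0
    have hy : 1 ≤ (1 + x) ^ t := one_le_pow₀ (by linarith)
    have hyx : (1 + x) ^ t ≤ (x + 6) ^ t := pow_le_pow_left₀ (by linarith) (by linarith) t
    have hpow : (x + 6) ^ (2 * (t + 1) + 1) = ((x + 6) ^ t) ^ 2 * (x + 6) ^ 3 := by ring
    rw [hpow]
    generalize (1 + x) ^ t = y at hs hy hyx
    generalize (x + 6) ^ t = z at hyx
    have h1 : S ^ 2 ≤ z ^ 2 := pow_le_pow_left₀ hs0 (hs.trans hyx) 2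
    have h2 : S ≤ z ^ 2 := by nlinarith
    have h3 : 0 ≤ z ^ 2 := sq_nonneg z
    have h4 : 16 + 32 * x ≤ (x + 6) ^ 3 := by nlinarith [pow_nonneg hx 3, pow_nonneg hx 2]
    calc 2 * (2 * (4 * S) + (4 * S) ^ 2 * x) = 16 * S + S ^ 2 * (32 * x) := by ring
      _ ≤ 16 * z ^ 2 + z ^ 2 * (32 * x) := by
        have := mul_le_mul_of_nonneg_right h1 (show 0 ≤ 32 * x by linarith)
        linarith
      _ = z ^ 2 * (16 + 32 * x) := by ring
      _ ≤ z ^ 2 * (x + 6) ^ 3 := mul_le_mul_of_nonneg_left h4 h3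

theorem covariance_nbhds_le_rootBound (hϑ : 0 < ϑ) (hW : ∀ u, 0 < W u)
    (hv : Function.Injective (Sum.elim v v'))
    {g : (Fin m → WeightedGraph n × WeightedGraph n) → ℝ}
    {g' : (Fin m' → WeightedGraph n × WeightedGraph n) → ℝ} (hg : Measurable g)
    (hg' : Measurable g') (hg1 : ∀ b, |g b| ≤ 1) (hg1' : ∀ b, |g' b| ≤ 1) :
    cov[fun ζ => g (nbhds ℓ F v ζ), fun ζ => g' (nbhds ℓ F' v' ζ); noiseLaw ϑ μV μE W] ≤
      rootBound ϑ 6 ℓ v v' W := by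
  refine le_min ?_ (covariance_le_one (hg.comp (measurable_nbhds F v))
    (hg'.comp (measurable_nbhds F' v')) (fun _ => hg1 _) (fun _ => hg1' _))
  refine (covariance_nbhds_le_touched hg hg' hg1 hg1').trans ?_
  have hΓ : ∀ p, 0 ≤ Gam ϑ W p := fun p =>
    div_nonneg (Finset.sum_nonneg fun a _ => pow_nonneg (hW a).le p) (by positivity)
  have hN : 0 ≤ n * ϑ := by positivity
  rw [Finset.sum_div, Finset.sum_mul, Finset.sum_mul, Finset.mul_sum]
  refine Finset.sum_le_sum fun i _ => ?_
  rw [Finset.sum_div, Finset.sum_mul, Finset.sum_mul, Finset.mul_sum]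
  refine Finset.sum_le_sum fun i' _ => ?_
  have hne : v i ≠ v' i' := fun h => Sum.inl_ne_inr (hv (a₁ := Sum.inl i) (a₂ := Sum.inr i') h)
  refine (mul_le_mul_of_nonneg_left (sum_touched_le hϑ hW hne) zero_le_two).trans ?_
  rw [mul_left_comm, mul_assoc]
  have hp := (hW (v i)).le
  have hp' := (hW (v' i')).le
  refine mul_le_mul ?_ ?_ ?_ ?_
  · exact div_le_div_of_nonneg_right (by nlinarith) hN
  · refine (geom_bound (hΓ 2) ℓ).trans ?_
    -- `Γ_3 + 1` enters only as a factor at least one.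
    exact le_mul_of_one_le_left (pow_nonneg (by linarith [hΓ 2]) _) (by linarith [hΓ 3])
  · have h0 : 0 ≤ ∑ j ∈ Finset.range ℓ, Gam ϑ W 2 ^ j :=
      Finset.sum_nonneg fun j _ => pow_nonneg (hΓ 2) j
    have := mul_nonneg (sq_nonneg (4 * ∑ j ∈ Finset.range ℓ, Gam ϑ W 2 ^ j)) (hΓ 2)
    linarith
  · exact div_nonneg (mul_nonneg (by linarith) (by linarith)) hN

theorem setBound_image_eq_rootBound (C : ℝ) (hv : Function.Injective (Sum.elim v v')) :
    setBound ϑ C ℓ (Finset.univ.image v) (Finset.univ.image v') W = rootBound ϑ C ℓ v v' W := by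
  have hsum : ∀ {k : ℕ} {w : Fin k → Fin n}, Function.Injective w →
      totalWeight W (Finset.univ.image w) + ((Finset.univ.image w).card : ℝ) =
        ∑ i, (W (w i) + 1) := by
    intro k w hw
    rw [totalWeight, Finset.sum_image fun _ _ _ _ h => hw h, Finset.card_image_of_injective _ hw,
      Finset.sum_add_distrib]
    simp
  rw [setBound, rootBound, hsum (w := v) (hv.comp Sum.inl_injective),
    hsum (w := v') (hv.comp Sum.inr_injective),
    Finset.sum_mul_sum]

end Bound

/-! ### Passage to the conditional law. -/

section Conditional

variable {Ω : Type*} [MeasurableSpace Ω] {μ : Measure Ω} [IsProbabilityMeasure μ] {n : ℕ}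
  {W : Ω → Fin n → ℝ} {ξ : Ω → Noise n}

theorem condCov_ae_eq_covariance_condDistrib (hW : Measurable W) (hξ : Measurable ξ)
    {f g : Noise n → ℝ} (hf : Measurable f) (hg : Measurable g)
    (hf1 : ∀ x, |f x| ≤ 1) (hg1 : ∀ x, |g x| ≤ 1) :
    condCov μ (MeasurableSpace.comap W inferInstance) (fun ω => f (ξ ω)) (fun ω => g (ξ ω))
      =ᵐ[μ] fun ω => cov[f, g; condDistrib ξ W μ (W ω)] := by
  have hcond : ∀ {h : Noise n → ℝ}, Measurable h → (∀ x, |h x| ≤ 1) →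
      μ[fun ω => h (ξ ω) | MeasurableSpace.comap W inferInstance] =ᵐ[μ]
        fun ω => ∫ y, h y ∂condDistrib ξ W μ (W ω) := fun hh hh1 =>
    condExp_ae_eq_integral_condDistrib hW hξ.aemeasurable hh.stronglyMeasurable
      (integrable_of_abs_le_one (hh.comp hξ) fun _ => hh1 _)
  filter_upwards [hcond hf hf1, hcond hg hg1, hcond (hf.mul hg) fun x => by
    rw [Pi.mul_apply, abs_mul]; exact mul_le_one₀ (hf1 x) (abs_nonneg _) (hg1 x)]
    with ω h1 h2 h3
  rw [covariance_eq_sub_of_abs_le_one hf hg hf1 hg1, ← h1, ← h2]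
  simp only [condCov, Pi.sub_apply, Pi.mul_apply] at h3 ⊢
  rw [← h3]

end Conditional

end InhomGraph

end

theorem mainTheorem4 :
    ∃ C : ℝ, 0 < C ∧
      ∀ {Ω : Type*} [MeasurableSpace Ω] (μ : Measure Ω) [IsProbabilityMeasure μ]
        (n : ℕ) (_ : 0 < n) (ϑ : ℝ) (_ : 0 < ϑ)
        (μV μE : Measure ℝ) [IsProbabilityMeasure μV] [IsProbabilityMeasure μE]
        (W : Ω → Fin n → ℝ) (ξ : Ω → InhomGraph.Noise n)
        (_ : InhomGraph.IsModel μ ϑ μV μE W ξ)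
        (m m' : ℕ) (v : Fin m → Fin n) (v' : Fin m' → Fin n)
        (_ : Function.Injective (Sum.elim v v'))
        (F F' : Set (InhomGraph.Site n)) (ℓ : ℕ),
        -- almost surely, the bound holds for all test functions simultaneously under the
        -- regular conditional law given the connectivity weights
        (∀ᵐ ω ∂μ,
          ∀ (g : (Fin m → InhomGraph.WeightedGraph n × InhomGraph.WeightedGraph n) → ℝ)
            (g' : (Fin m' → InhomGraph.WeightedGraph n × InhomGraph.WeightedGraph n) → ℝ),
            Measurable g → Measurable g' → (∀ b, |g b| ≤ 1) → (∀ b, |g' b| ≤ 1) →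
            cov[fun ζ => g (InhomGraph.nbhds ℓ F v ζ), fun ζ => g' (InhomGraph.nbhds ℓ F' v' ζ);
                condDistrib ξ W μ (W ω)] ≤ InhomGraph.rootBound ϑ C ℓ v v' (W ω) ∧
            cov[fun ζ => g (InhomGraph.nbhds ℓ F v ζ), fun ζ => g' (InhomGraph.nbhds ℓ F' v' ζ);
                condDistrib ξ W μ (W ω)] ≤
              InhomGraph.setBound ϑ C ℓ (Finset.univ.image v) (Finset.univ.image v') (W ω)) ∧
        -- the same bounds for the conditional covariance given the σ-algebra generated by `W`
        (∀ (g : (Fin m → InhomGraph.WeightedGraph n × InhomGraph.WeightedGraph n) → ℝ)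
            (g' : (Fin m' → InhomGraph.WeightedGraph n × InhomGraph.WeightedGraph n) → ℝ),
            Measurable g → Measurable g' → (∀ b, |g b| ≤ 1) → (∀ b, |g' b| ≤ 1) →
            ∀ᵐ ω ∂μ,
              InhomGraph.condCov μ (MeasurableSpace.comap W inferInstance)
                  (fun ω => g (InhomGraph.nbhds ℓ F v (ξ ω)))
                  (fun ω => g' (InhomGraph.nbhds ℓ F' v' (ξ ω))) ω
                ≤ InhomGraph.rootBound ϑ C ℓ v v' (W ω) ∧
              InhomGraph.condCov μ (MeasurableSpace.comap W inferInstance)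
                  (fun ω => g (InhomGraph.nbhds ℓ F v (ξ ω)))
                  (fun ω => g' (InhomGraph.nbhds ℓ F' v' (ξ ω))) ω
                ≤ InhomGraph.setBound ϑ C ℓ (Finset.univ.image v) (Finset.univ.image v')
                    (W ω)) := by

  refine ⟨6, by norm_num, ?_⟩
  intro Ω _ μ _ n _ ϑ hϑ μV μE _ _ W ξ hmodel m m' v v' hv F F' ℓ
  have key : ∀ᵐ ω ∂μ,
      ∀ (g : (Fin m → InhomGraph.WeightedGraph n × InhomGraph.WeightedGraph n) → ℝ)
        (g' : (Fin m' → InhomGraph.WeightedGraph n × InhomGraph.WeightedGraph n) → ℝ),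
        Measurable g → Measurable g' → (∀ b, |g b| ≤ 1) → (∀ b, |g' b| ≤ 1) →
        cov[fun ζ => g (InhomGraph.nbhds ℓ F v ζ), fun ζ => g' (InhomGraph.nbhds ℓ F' v' ζ);
          condDistrib ξ W μ (W ω)] ≤ InhomGraph.rootBound ϑ 6 ℓ v v' (W ω) := by
    -- The only exceptional set is where the conditional law differs from `noiseLaw`; it is
    -- independent of `g` and `g'`, so the bound is uniform in them.
    filter_upwards [hmodel.condLaw] with ω hω g g' hg hg' hg1 hg1'
    rw [hω]
    exact InhomGraph.covariance_nbhds_le_rootBound hϑ (hmodel.W_pos ω) hv hg hg' hg1 hg1'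
  refine ⟨?_, fun g g' hg hg' hg1 hg1' => ?_⟩
  · filter_upwards [key] with ω hω g g' hg hg' hg1 hg1'
    rw [InhomGraph.setBound_image_eq_rootBound 6 hv]
    exact ⟨hω g g' hg hg' hg1 hg1', hω g g' hg hg' hg1 hg1'⟩
  · filter_upwards [key, InhomGraph.condCov_ae_eq_covariance_condDistrib hmodel.measurable_W
      hmodel.measurable_ξ (hg.comp (InhomGraph.measurable_nbhds (ℓ := ℓ) F v))
      (hg'.comp (InhomGraph.measurable_nbhds (ℓ := ℓ) F' v')) (fun _ => hg1 _) (fun _ => hg1' _)]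
      with ω hω hcov
    rw [InhomGraph.setBound_image_eq_rootBound 6 hv]
    have hle := hcov.trans_le (hω g g' hg hg' hg1 hg1')
    exact ⟨hle, hle⟩
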